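/- For $d \ge 1$ let $\mathbb{H}_d$ be the $d$-dimensional discrete hypercube, i.e. the graph on $\{0,1\}^d$ in which two vertices are adjacent when they differ in exactly one coordinate, and let $d(\cdot,\cdot)$ be the graph distance (which is the Hamming distance). For vertices $a,b$ let $$\widehat m(a,b)=\{u : d(a,u)+d(u,b)=d(a,b),\ d(a,u)\in\{\lfloor d(a,b)/2\rfloor,\lceil d(a,b)/2\rceil\}\},$$ and for nonempty vertex sets $S,T$ let $\widehat m(S,T)=\bigcup_{a\in S,\,b\in T}\widehat m(a,b)$ and $d_*(S,T)=\min\{d(s,t): s\in S,\ t\in T\}$. The Brunn–Minkowski curvature of $\mathbb{H}_d$ is the supremum of all real $K$ such that $$|\widehat m(S,T)|\ \ge\ \sqrt{|S||T|}\;e^{\frac K8 d_*(S,T)^2}\qquad\text{for all nonempty } S,T\subseteq\{0,1\}^d. \tag{$*$}$$ There exist $\delta>0$ and $D$ such that for every $d>D$ the inequality $(*)$ holds with $K=\frac{1+\delta}{2d}$. Hence the Brunn–Minkowski curvature of $\mathbb{H}_d$ is at least $\frac{1}{2d}(1+\delta)$, and so is strictly larger than the Ollivier–Villani constant $\frac1{2d}$.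 -/

import Mathlib

/-- The `d`-dimensional discrete hypercube: the graph on `{0,1}^d` in which two vertices are
adjacent when they differ in exactly one coordinate. -/
def hypercubeGraph (d : ℕ) : SimpleGraph (Fin d → Bool) where
  Adj x y := hammingDist x y = 1
  symm := ⟨fun x y h => by rw [hammingDist_comm]; exact h⟩
  loopless := ⟨fun x h => by simp at h⟩

/-- Flipping one differing coordinate: there is a walk whose length is the Hamming distance. -/
theorem hypercubeGraph_exists_walk (d : ℕ) (n : ℕ) :
    ∀ x y : Fin d → Bool, hammingDist x y = n →
      ∃ p : (hypercubeGraph d).Walk x y, p.length = n := by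
  induction n with
  | zero =>
    intro x y h
    obtain rfl := hammingDist_eq_zero.1 h
    exact ⟨SimpleGraph.Walk.nil, rfl⟩
  | succ n ih =>
    intro x y h
    have hne : x ≠ y := by
      rintro rfl
      simp at h
    obtain ⟨i, hi⟩ := Function.ne_iff.1 hne
    have hadj : (hypercubeGraph d).Adj x (Function.update x i (y i)) := by
      change (Finset.univ.filter fun j => x j ≠ Function.update x i (y i) j).card = 1
      rw [Finset.card_eq_one]
      refine ⟨i, ?_⟩
      ext j
      by_cases hj : j = i
      · subst hj
        simp [hi]
      · simp [hj]
    have hdist : hammingDist (Function.update x i (y i)) y = n := by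
      have hset : (Finset.univ.filter fun j => Function.update x i (y i) j ≠ y j)
          = (Finset.univ.filter fun j => x j ≠ y j).erase i := by
        ext j
        by_cases hj : j = i
        · subst hj
          simp
        · simp [hj]
      have h' : (Finset.univ.filter fun j => x j ≠ y j).card = n + 1 := h
      change (Finset.univ.filter fun j => Function.update x i (y i) j ≠ y j).card = n
      rw [hset, Finset.card_erase_of_mem (by simpa using hi), h']
      rfl
    obtain ⟨p, hp⟩ := ih _ _ hdist
    exact ⟨SimpleGraph.Walk.cons hadj p, by simp [hp]⟩

theorem hypercubeGraph_hammingDist_le_length (d : ℕ) (x y : Fin d → Bool)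
    (p : (hypercubeGraph d).Walk x y) : hammingDist x y ≤ p.length := by
  induction p with
  | nil => simp
  | @cons u v w h p ih =>
    have h1 : hammingDist u v = 1 := h
    have h2 := hammingDist_triangle u v w
    rw [SimpleGraph.Walk.length_cons]
    omega

theorem hypercubeGraph_connected (d : ℕ) : (hypercubeGraph d).Connected :=
  { preconnected := fun x y => (hypercubeGraph_exists_walk d _ x y rfl).choose.reachable
    nonempty := ⟨fun _ => false⟩ }

/-- The graph distance of the hypercube is the Hamming distance. -/
theorem hypercubeGraph_dist (d : ℕ) (x y : Fin d → Bool) :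
    (hypercubeGraph d).dist x y = hammingDist x y := by
  apply le_antisymm
  · obtain ⟨p, hp⟩ := hypercubeGraph_exists_walk d _ x y rfl
    exact hp ▸ SimpleGraph.dist_le p
  · obtain ⟨p, hp⟩ := (hypercubeGraph_connected d).exists_walk_length_eq_dist x y
    exact hp ▸ hypercubeGraph_hammingDist_le_length d x y p

/-- `u` is a symmetric discrete midpoint of `a` and `b`: it lies on a geodesic from `a` to `b`, and
`d(a,u)` is `⌊d(a,b)/2⌋` or `⌈d(a,b)/2⌉`. The division is that of `ℕ`, so that
`n / 2 = ⌊n/2⌋` and `(n + 1) / 2 = ⌈n/2⌉`. -/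
def SimpleGraph.IsSymmMidpoint {V : Type*} (G : SimpleGraph V) (a b u : V) : Prop :=
  G.dist a u + G.dist u b = G.dist a b ∧
    (G.dist a u = G.dist a b / 2 ∨ G.dist a u = (G.dist a b + 1) / 2)

open Classical in
/-- The set of symmetric discrete midpoints between a point of `S` and a point of `T`. -/
noncomputable def SimpleGraph.symmMidpoints {V : Type*} [Fintype V] (G : SimpleGraph V)
    (S T : Finset V) : Finset V :=
  Finset.univ.filter fun u => ∃ a ∈ S, ∃ b ∈ T, G.IsSymmMidpoint a b u

/-- The distance `d_*(S,T) = min {d(s,t) : s ∈ S, t ∈ T}` between two nonempty sets of vertices. -/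
noncomputable def SimpleGraph.setDist {V : Type*} (G : SimpleGraph V) (S T : Finset V) : ℕ :=
  sInf {n : ℕ | ∃ s ∈ S, ∃ t ∈ T, G.dist s t = n}

/-- The discrete curved Brunn–Minkowski inequality with constant `K`, for a finite connected
graph. -/
def SimpleGraph.SatisfiesBrunnMinkowski {V : Type*} [Fintype V] (G : SimpleGraph V) (K : ℝ) :
    Prop :=
  ∀ S T : Finset V, S.Nonempty → T.Nonempty →
    Real.sqrt ((S.card : ℝ) * (T.card : ℝ)) * Real.exp (K / 8 * (G.setDist S T : ℝ) ^ 2)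
      ≤ ((G.symmMidpoints S T).card : ℝ)

/-- The Brunn–Minkowski curvature: the supremum, among the extended reals, of the constants `K`
for which the inequality holds. -/
noncomputable def SimpleGraph.brunnMinkowskiCurvature {V : Type*} [Fintype V]
    (G : SimpleGraph V) : EReal :=
  sSup {x : EReal | ∃ K : ℝ, G.SatisfiesBrunnMinkowski K ∧ x = (K : EReal)}

/-! The proof counts crossovers. Flipping a set `A` of half of the coordinates where `x` and `y`
differ, in both points at once, preserves their difference set and is undone by repetition; `x` and
`y` are then midpoints of the flipped pair. Give each pair the uniform probability on its sets `A`.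
Reindexing by this involution bounds `|S||T|` by a sum, over pairs of midpoints `(x, y)`, of the
proportion of `A` whose crossover lies in `S × T`.

For fixed `x`, `y`, let `F` be this family of `A` and `s` the difference set. Combining the first
point for `A` with the second for `B` shows that `A` and `s \ B` differ in at least `d_*(S,T)`
places for all `A`, `B` in `F`. So `F` is far from its family of complements, which has the same
size, and concentration on the slice makes both small (`card_le_of_far_from_compl`).

The constant is decided in `sum_exp_powersetCard_le`. Revealing one element at a time is routine,
but choosing a balanced element at each step (`exists_balanced_coordinate`) halves the gap between
conditional means, dividing the variance by about four. This leaves room for the crude bound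
`sliceVariance N ≤ 3 * N`. -/

open MeasureTheory ProbabilityTheory in
/-- Hoeffding's lemma for a two-point distribution. -/
theorem two_point_exp_le {p : ℝ} (h0 : 0 ≤ p) (h1 : p ≤ 1) (u v : ℝ) :
    p * Real.exp u + (1 - p) * Real.exp v
      ≤ Real.exp (p * u + (1 - p) * v + (u - v) ^ 2 / 8) := by
  have key : ∀ a b : ℝ, a ≤ b → ∀ q : ℝ, 0 ≤ q → q ≤ 1 →
      q * Real.exp b + (1 - q) * Real.exp a
        ≤ Real.exp (q * b + (1 - q) * a + (b - a) ^ 2 / 8) := by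
    intro a b hab q hq0 hq1
    let μ : Measure Bool := ENNReal.ofReal q • Measure.dirac true
      + ENNReal.ofReal (1 - q) • Measure.dirac false
    have hμ : IsProbabilityMeasure μ := ⟨by
      simp only [μ, Measure.add_apply, Measure.smul_apply, measure_univ, smul_eq_mul, mul_one]
      rw [← ENNReal.ofReal_add hq0 (by linarith)]
      simp⟩
    have hint : ∀ g : Bool → ℝ, ∫ x, g x ∂μ = q * g true + (1 - q) * g false := by
      intro g
      simp only [μ]
      rw [integral_add_measure (Integrable.of_finite.smul_measure ENNReal.ofReal_ne_top)
        (Integrable.of_finite.smul_measure ENNReal.ofReal_ne_top), integral_smul_measure,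
        integral_smul_measure, integral_dirac, integral_dirac,
        ENNReal.toReal_ofReal hq0, ENNReal.toReal_ofReal (by linarith)]
      simp
    have hh := hasSubgaussianMGF_of_mem_Icc (μ := μ) (X := fun x : Bool => if x then b else a)
      (a := a) (b := b) (measurable_of_finite _).aemeasurable
      (Filter.Eventually.of_forall fun x => by cases x <;> simp [hab])
    have := hh.mgf_le 1
    rw [mgf, hint, hint] at this
    simp only [if_true, Bool.false_eq_true, if_false, one_mul] at this
    set m := q * b + (1 - q) * a with hm
    have e1 : Real.exp b = Real.exp m * Real.exp (b - m) := by rw [← Real.exp_add]; ring_nf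
    have e2 : Real.exp a = Real.exp m * Real.exp (a - m) := by rw [← Real.exp_add]; ring_nf
    rw [Real.exp_add, e1, e2]
    have h3 : ((‖b - a‖₊ / 2) ^ 2 : NNReal) * (1 : ℝ) ^ 2 / 2 = (b - a) ^ 2 / 8 := by
      push_cast
      rw [Real.norm_eq_abs, div_pow, sq_abs]
      ring
    rw [h3] at this
    nlinarith [Real.exp_pos m]
  rcases le_total v u with h | h
  · exact key v u h p h0 h1
  · have := key u v h (1 - p) (by linarith) (by linarith)
    rw [show p * u + (1 - p) * v + (u - v) ^ 2 / 8
      = (1 - p) * v + (1 - (1 - p)) * u + (v - u) ^ 2 / 8 by ring]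
    linarith

/-- Reals with sum zero and pairwise distances at most `R` include one of modulus at most `R / 2`. -/
theorem exists_abs_le_half {ι : Type*} {s : Finset ι} (hs : s.Nonempty) {g : ι → ℝ} {R : ℝ}
    (h0 : ∑ i ∈ s, g i = 0) (hR : ∀ i ∈ s, ∀ j ∈ s, |g i - g j| ≤ R) :
    ∃ i ∈ s, |g i| ≤ R / 2 := by
  -- Here `g a ≤ 0 ≤ g b`; as the two are within `R`, they cannot both exceed `R / 2` in modulus.
  obtain ⟨a, ha, ha'⟩ := Finset.exists_le_of_sum_le hs (f := g) (g := fun _ => 0) (by simp [h0])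
  obtain ⟨b, hb, hb'⟩ := Finset.exists_le_of_sum_le hs (f := fun _ => 0) (g := g) (by simp [h0])
  have h := abs_le.1 (hR a ha b hb)
  by_cases h1 : - (R / 2) ≤ g a
  · exact ⟨a, ha, abs_le.2 ⟨h1, by have := abs_nonneg (g a - g b); have := hR a ha b hb; linarith⟩⟩
  · refine ⟨b, hb, abs_le.2 ⟨?_, ?_⟩⟩ <;> linarith

/-! ### Subgaussian concentration on the `k`-subsets of a finite set -/

section Slice

variable {α : Type*} [DecidableEq α]

/-- `f` changes by at most `r` when one element of a subset of `s` is exchanged for another. -/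
def IsSwapLipschitzOn (s : Finset α) (r : ℝ) (f : Finset α → ℝ) : Prop :=
  ∀ B ⊆ s, ∀ x ∈ s, ∀ y ∈ s, x ∉ B → y ∉ B → |f (insert x B) - f (insert y B)| ≤ r

theorem sum_powersetCard_mem_not_mem (s : Finset α) (k : ℕ) (f : Finset α → ℝ) {i j : α}
    (hi : i ∈ s) (hij : i ≠ j) :
    ∑ A ∈ (s.powersetCard (k + 1)).filter (fun A => i ∈ A ∧ j ∉ A), f A
      = ∑ B ∈ ((s.erase i).erase j).powersetCard k, f (insert i B) := by
  refine Finset.sum_nbij' (fun A => A.erase i) (fun B => insert i B) ?_ ?_ ?_ ?_ ?_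
  · intro A hA
    simp only [Finset.mem_filter, Finset.mem_powersetCard] at hA ⊢
    obtain ⟨⟨h1, h2⟩, h3, h4⟩ := hA
    refine ⟨?_, by rw [Finset.card_erase_of_mem h3, h2]; rfl⟩
    intro x hx
    simp only [Finset.mem_erase] at hx ⊢
    exact ⟨fun h => h4 (h ▸ hx.2), hx.1, h1 hx.2⟩
  · intro B hB
    simp only [Finset.mem_filter, Finset.mem_powersetCard] at hB ⊢
    have hiB : i ∉ B := fun h => by simpa using hB.1 h
    have hjB : j ∉ B := fun h => by simpa using hB.1 h
    refine ⟨⟨?_, by rw [Finset.card_insert_of_notMem hiB, hB.2]⟩, by simp, by simp [hij.symm, hjB]⟩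
    refine Finset.insert_subset hi (hB.1.trans ?_)
    exact (Finset.erase_subset _ _).trans (Finset.erase_subset _ _)
  · intro A hA
    simp only [Finset.mem_filter] at hA
    exact Finset.insert_erase hA.2.1
  · intro B hB
    simp only [Finset.mem_powersetCard] at hB
    exact Finset.erase_insert fun h => by simpa using hB.1 h
  · intro A hA
    simp only [Finset.mem_filter] at hA
    rw [Finset.insert_erase hA.2.1]

/-- Sets containing both `i` and `j` cancel; the others pair off by exchanging `i` for `j`. -/
theorem sum_powersetCard_mem_sub (s : Finset α) (k : ℕ) (f : Finset α → ℝ) {i j : α}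
    (hi : i ∈ s) (hj : j ∈ s) (hij : i ≠ j) :
    ∑ A ∈ (s.powersetCard (k + 1)).filter (i ∈ ·), f A
        - ∑ A ∈ (s.powersetCard (k + 1)).filter (j ∈ ·), f A
      = ∑ B ∈ ((s.erase i).erase j).powersetCard k, (f (insert i B) - f (insert j B)) := by
  rw [Finset.sum_sub_distrib, ← sum_powersetCard_mem_not_mem s k f hi hij,
    Finset.erase_right_comm, ← sum_powersetCard_mem_not_mem s k f hj hij.symm,
    ← Finset.sum_filter_add_sum_filter_not ((s.powersetCard (k + 1)).filter (i ∈ ·)) (j ∈ ·),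
    ← Finset.sum_filter_add_sum_filter_not ((s.powersetCard (k + 1)).filter (j ∈ ·)) (i ∈ ·)]
  simp only [Finset.filter_filter]
  rw [Finset.filter_congr (p := fun A => i ∈ A ∧ j ∈ A) (q := fun A => j ∈ A ∧ i ∈ A)
    (fun _ _ => and_comm)]
  ring

theorem sum_sum_powersetCard_mem (s : Finset α) (k : ℕ) (f : Finset α → ℝ) :
    ∑ i ∈ s, ∑ A ∈ (s.powersetCard k).filter (i ∈ ·), f A
      = k * ∑ A ∈ s.powersetCard k, f A := by
  simp only [Finset.sum_filter]
  rw [Finset.sum_comm, Finset.mul_sum]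
  refine Finset.sum_congr rfl fun A hA => ?_
  rw [Finset.mem_powersetCard] at hA
  rw [← Finset.sum_filter, Finset.filter_mem_eq_inter, Finset.inter_eq_right.2 hA.1,
    Finset.sum_const, hA.2, nsmul_eq_mul]

/-- The deviations sum to zero by double counting, and any two differ by at most `M.choose k * r`,
one exchange for each set `B`. Hence some element has at most half of that deviation. -/
theorem exists_balanced_coordinate {s : Finset α} {M k : ℕ} (hs : s.card = M + 2) {r : ℝ}
    (hr : 0 ≤ r) {f : Finset α → ℝ} (hf : IsSwapLipschitzOn s r f) :
    ∃ i ∈ s, |∑ A ∈ (s.powersetCard (k + 1)).filter (i ∈ ·), f A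
      - (k + 1) / (M + 2) * ∑ A ∈ s.powersetCard (k + 1), f A| ≤ M.choose k * r / 2 := by
  have hs0 : s.Nonempty := Finset.card_pos.1 (by omega)
  refine exists_abs_le_half hs0 ?_ ?_
  · rw [Finset.sum_sub_distrib, sum_sum_powersetCard_mem, Finset.sum_const, hs, nsmul_eq_mul]
    push_cast
    field_simp
    ring
  · intro i hi j hj
    rw [sub_sub_sub_cancel_right]
    by_cases hij : i = j
    · subst hij
      simp only [sub_self, abs_zero]
      positivity
    rw [sum_powersetCard_mem_sub s k f hi hj hij]
    have hc : (((s.erase i).erase j).powersetCard k).card = M.choose k := by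
      rw [Finset.card_powersetCard, Finset.card_erase_of_mem (by simp [hj, Ne.symm hij]),
        Finset.card_erase_of_mem hi, hs]
      rfl
    refine (Finset.abs_sum_le_sum_abs _ _).trans ?_
    rw [← hc, ← nsmul_eq_mul]
    refine Finset.sum_le_card_nsmul _ _ _ fun B hB => ?_
    rw [Finset.mem_powersetCard] at hB
    refine hf B (hB.1.trans ((Finset.erase_subset _ _).trans (Finset.erase_subset _ _))) i hi j hj
      (fun h => by simpa using hB.1 h) (fun h => by simpa using hB.1 h)

/-- The sum of the squared ranges in the concentration inequality on slices. -/
noncomputable def sliceVariance (N : ℕ) : ℝ := ∑ m ∈ Finset.range N, (((m : ℝ) + 1) / m) ^ 2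

theorem sliceVariance_nonneg (N : ℕ) : 0 ≤ sliceVariance N :=
  Finset.sum_nonneg fun _ _ => sq_nonneg _

theorem sliceVariance_le (N : ℕ) : sliceVariance N ≤ 3 * N := by
  -- The term `m = 0` vanishes because division by zero gives zero; the term `m = 1` is 4, and all
  -- later ones are at most 9/4.
  have h : ∀ n : ℕ, sliceVariance (n + 2) ≤ 3 * n + 4 := by
    intro n
    induction n with
    | zero => norm_num [sliceVariance, Finset.sum_range_succ]
    | succ n ih =>
      rw [sliceVariance, Finset.sum_range_succ, ← sliceVariance]
      push_cast
      have : (((n : ℝ) + 2 + 1) / (n + 2)) ^ 2 ≤ 3 := by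
        rw [div_pow, div_le_iff₀ (by positivity)]
        nlinarith [(n.cast_nonneg : (0 : ℝ) ≤ n)]
      linarith
  match N with
  | 0 => simp [sliceVariance]
  | 1 => simp [sliceVariance]
  | n + 2 =>
    have := h n
    push_cast
    linarith

theorem sum_powersetCard_succ_split {s : Finset α} {i : α} (hi : i ∈ s) (k : ℕ)
    (f : Finset α → ℝ) :
    ∑ A ∈ s.powersetCard (k + 1), f A = ∑ B ∈ (s.erase i).powersetCard k, f (insert i B)
      + ∑ A ∈ (s.erase i).powersetCard (k + 1), f A := by
  have hd : Disjoint ((s.erase i).powersetCard (k + 1))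
      (((s.erase i).powersetCard k).image (insert i)) := by
    rw [Finset.disjoint_left]
    intro A hA hA'
    rw [Finset.mem_powersetCard] at hA
    obtain ⟨B, -, rfl⟩ := Finset.mem_image.1 hA'
    simpa using hA.1 (Finset.mem_insert_self i B)
  conv_lhs => rw [← Finset.insert_erase hi, Finset.powersetCard_succ_insert (by simp)]
  rw [Finset.sum_union hd, Finset.sum_image, add_comm]
  intro A hA B hB h
  simp only [Finset.mem_coe, Finset.mem_powersetCard] at hA hB
  rw [← Finset.erase_insert (fun h => by simpa using hA.1 h : i ∉ A), h,
    Finset.erase_insert (fun h => by simpa using hB.1 h : i ∉ B)]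

theorem sum_powersetCard_filter_mem {s : Finset α} {i : α} (hi : i ∈ s) (k : ℕ)
    (f : Finset α → ℝ) :
    ∑ A ∈ (s.powersetCard (k + 1)).filter (i ∈ ·), f A
      = ∑ B ∈ (s.erase i).powersetCard k, f (insert i B) := by
  rw [Finset.sum_filter, sum_powersetCard_succ_split hi]
  rw [Finset.sum_eq_zero (s := (s.erase i).powersetCard (k + 1)), add_zero]
  · simp
  · intro A hA
    rw [Finset.mem_powersetCard] at hA
    exact if_neg fun h => by simpa using hA.1 h

/-- A function of the `k`-subsets of an `N`-set that is Lipschitz for exchanges is subgaussian. -/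
theorem sum_exp_powersetCard_le {r : ℝ} (hr : 0 ≤ r) (N : ℕ) :
    ∀ (s : Finset α) (k : ℕ) (f : Finset α → ℝ), s.card = N → IsSwapLipschitzOn s r f →
      ∑ A ∈ s.powersetCard k, Real.exp (f A)
        ≤ N.choose k * Real.exp ((∑ A ∈ s.powersetCard k, f A) / N.choose k
          + r ^ 2 / 32 * sliceVariance N) := by
  induction N with
  | zero =>
    intro s k f hs hf
    obtain rfl := Finset.card_eq_zero.1 hs
    cases k with
    | zero => simp [sliceVariance]
    | succ k => rw [Finset.powersetCard_eq_empty.2 (by simp)]; simp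
  | succ N ih =>
    intro s k f hs hf
    have hv := sliceVariance_nonneg (N + 1)
    have hv' : 0 ≤ r ^ 2 / 32 * sliceVariance (N + 1) := by positivity
    rcases k with _ | k
    · simpa using hv'
    -- An empty slice and a one-set slice are settled first, so that both parts of the split at `i`
    -- are nonempty.
    rcases lt_trichotomy N k with h | h | h
    · rw [Finset.powersetCard_eq_empty.2 (by omega), Nat.choose_eq_zero_of_lt (by omega)]
      simp
    · subst h
      rw [← hs, Finset.powersetCard_self, hs]
      simpa using hv'
    obtain ⟨M, rfl⟩ : ∃ M, N = M + 1 := ⟨N - 1, by omega⟩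
    obtain ⟨i, hi, hbal⟩ := exists_balanced_coordinate (k := k) hs hr hf
    have hcard : (s.erase i).card = M + 1 := by rw [Finset.card_erase_of_mem hi, hs]; rfl
    have hsub : s.erase i ⊆ s := Finset.erase_subset _ _
    have hI1 := ih (s.erase i) k (fun B => f (insert i B)) hcard (by
      intro B hB x hx y hy hxB hyB
      change |f (insert i (insert x B)) - f (insert i (insert y B))| ≤ r
      rw [Finset.insert_comm i x, Finset.insert_comm i y]
      simp only [Finset.mem_erase] at hx hy
      exact hf _ (Finset.insert_subset hi (hB.trans hsub)) x hx.2 y hy.2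
        (by simp [hx.1, hxB]) (by simp [hy.1, hyB]))
    have hI0 := ih (s.erase i) (k + 1) f hcard fun B hB x hx y hy =>
      hf B (hB.trans hsub) x (hsub hx) y (hsub hy)
    rw [sum_powersetCard_filter_mem hi] at hbal
    rw [sum_powersetCard_succ_split hi] at hbal
    rw [sum_powersetCard_succ_split hi, sum_powersetCard_succ_split hi]
    set X := ∑ B ∈ (s.erase i).powersetCard k, f (insert i B)
    set Y := ∑ A ∈ (s.erase i).powersetCard (k + 1), f A
    refine (add_le_add hI1 hI0).trans ?_
    have hn1 : (0 : ℝ) < (M + 1).choose k := by exact_mod_cast Nat.choose_pos (by omega)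
    have hn0 : (0 : ℝ) < (M + 1).choose (k + 1) := by exact_mod_cast Nat.choose_pos (by omega)
    have hT : ((M + 1 + 1).choose (k + 1) : ℝ) = (M + 1).choose k + (M + 1).choose (k + 1) := by
      exact_mod_cast Nat.choose_succ_succ _ _
    have h1 : ((M : ℝ) + 2) * (M + 1).choose k = (M + 1 + 1).choose (k + 1) * (k + 1) := by
      have := Nat.add_one_mul_choose_eq (M + 1) k
      have := congrArg (Nat.cast (R := ℝ)) this
      push_cast at this
      linarith
    have h2 : ((M : ℝ) + 1) * M.choose k = (M + 1).choose (k + 1) * (k + 1) := by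
      exact_mod_cast Nat.add_one_mul_choose_eq M k
    rw [hT] at h1 ⊢
    have hvar : sliceVariance (M + 1 + 1)
        = sliceVariance (M + 1) + (((M : ℝ) + 2) / (M + 1)) ^ 2 := by
      rw [sliceVariance, Finset.sum_range_succ, ← sliceVariance]
      push_cast
      ring_nf
    rw [hvar]
    set n1 : ℝ := (((M + 1).choose k : ℕ) : ℝ)
    set n0 : ℝ := (((M + 1).choose (k + 1) : ℕ) : ℝ)
    set q : ℝ := ((M.choose k : ℕ) : ℝ)
    set V := r ^ 2 / 32 * sliceVariance (M + 1) with hV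
    have hk : ((k : ℝ) + 1) / (M + 2) = n1 / (n1 + n0) := by
      rw [div_eq_div_iff (by positivity) (by positivity)]
      linarith
    -- The gap between the means over sets with and without `i` is the deviation in `hbal`,
    -- rescaled. Balance provides the factor 1/2.
    have hdiff : |X / n1 - Y / n0| ≤ r / 2 * ((M + 2) / (M + 1)) := by
      have e : X / n1 - Y / n0 = (X - (k + 1) / (M + 2) * (X + Y)) * ((n1 + n0) / (n1 * n0)) := by
        rw [hk]; field_simp; ring
      have e2 : q * r / 2 * ((n1 + n0) / (n1 * n0)) = r / 2 * ((M + 2) / (M + 1)) := by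
        have hM : (0 : ℝ) < (M : ℝ) + 1 := by positivity
        have hq : q * (n1 + n0) * (M + 1) = (M + 2) * (n1 * n0) := by
          linear_combination (n1 + n0) * h2 - n0 * h1
        field_simp
        linear_combination r * hq
      rw [e, abs_mul, abs_of_pos (by positivity : 0 < (n1 + n0) / (n1 * n0)), ← e2]
      gcongr
    have hsq : (X / n1 - Y / n0) ^ 2 / 8 ≤ r ^ 2 / 32 * (((M : ℝ) + 2) / (M + 1)) ^ 2 := by
      have := sq_le_sq' (abs_le.1 hdiff).1 (abs_le.1 hdiff).2
      nlinarith
    have htp := two_point_exp_le (p := n1 / (n1 + n0)) (by positivity)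
      ((div_le_one (by positivity)).2 (by linarith)) (X / n1) (Y / n0)
    have e3 : 1 - n1 / (n1 + n0) = n0 / (n1 + n0) := by field_simp; ring
    have e4 : n1 / (n1 + n0) * (X / n1) + n0 / (n1 + n0) * (Y / n0) = (X + Y) / (n1 + n0) := by
      field_simp
    rw [e3, e4] at htp
    calc n1 * Real.exp (X / n1 + V) + n0 * Real.exp (Y / n0 + V)
        = (n1 + n0) * (n1 / (n1 + n0) * Real.exp (X / n1)
            + n0 / (n1 + n0) * Real.exp (Y / n0)) * Real.exp V := by
          rw [Real.exp_add, Real.exp_add]; field_simp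
      _ ≤ (n1 + n0) * Real.exp ((X + Y) / (n1 + n0) + (X / n1 - Y / n0) ^ 2 / 8)
            * Real.exp V := by gcongr
      _ = (n1 + n0) * Real.exp ((X + Y) / (n1 + n0) + (X / n1 - Y / n0) ^ 2 / 8 + V) := by
          rw [mul_assoc, ← Real.exp_add]
      _ ≤ _ := by
          refine mul_le_mul_of_nonneg_left (Real.exp_le_exp.2 ?_) (by positivity)
          rw [mul_add, ← hV]
          linarith

end Slice

/-! ### Families of half-subsets far from their complements -/

section Isoperimetry

/-- Concentration on the slice: the sets on which a function with Lipschitz constant `2` for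
exchanges is nonpositive, respectively at least `D`, cannot both be large. -/
theorem card_mul_card_le_of_isSwapLipschitzOn {α : Type*} [DecidableEq α] {t : Finset α} {k : ℕ}
    {f : Finset α → ℝ} (hf : IsSwapLipschitzOn t 2 f) {G H : Finset (Finset α)}
    (hG : G ⊆ t.powersetCard k) (hH : H ⊆ t.powersetCard k) {D c : ℝ} (hD : 0 ≤ D)
    (hfG : ∀ A ∈ G, f A ≤ 0) (hfH : ∀ A ∈ H, D ≤ f A) (hc : 0 < c)
    (htc : sliceVariance t.card ≤ c) :
    (G.card : ℝ) * H.card ≤ ((t.powersetCard k).card : ℝ) ^ 2 * Real.exp (-(D ^ 2 / c)) := by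
  -- This value minimises the final exponent `l ^ 2 * c / 4 - l * D`.
  set l : ℝ := 2 * D / c with hl
  have hl0 : 0 ≤ l := by positivity
  have lip : ∀ σ : ℝ, |σ| = l → IsSwapLipschitzOn t (2 * l) (fun A => σ * f A) := by
    intro σ hσ B hB x hx y hy hxB hyB
    change |σ * f (insert x B) - σ * f (insert y B)| ≤ 2 * l
    rw [← mul_sub, abs_mul, hσ, mul_comm]
    exact mul_le_mul_of_nonneg_right (hf B hB x hx y hy hxB hyB) hl0
  have hp := sum_exp_powersetCard_le (by positivity) _ t k _ rfl (lip l (abs_of_nonneg hl0))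
  have hn := sum_exp_powersetCard_le (by positivity) _ t k _ rfl
    (lip (-l) (by rw [abs_neg, abs_of_nonneg hl0]))
  simp only [← Finset.mul_sum, ← Finset.card_powersetCard] at hp hn
  set T : ℝ := ((t.powersetCard k).card : ℝ)
  set m := ∑ A ∈ t.powersetCard k, f A
  set V := (2 * l) ^ 2 / 32 * sliceVariance t.card
  have hH' : (H.card : ℝ) * Real.exp (l * D) ≤ T * Real.exp (l * m / T + V) := by
    refine le_trans ?_ hp
    refine le_trans ?_ (Finset.sum_le_sum_of_subset_of_nonneg hH fun _ _ _ => (Real.exp_pos _).le)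
    rw [← nsmul_eq_mul]
    refine Finset.card_nsmul_le_sum _ _ _ fun A hA => ?_
    exact Real.exp_le_exp.2 (mul_le_mul_of_nonneg_left (hfH A hA) hl0)
  have hG' : (G.card : ℝ) ≤ T * Real.exp (-l * m / T + V) := by
    refine le_trans ?_ hn
    refine le_trans ?_ (Finset.sum_le_sum_of_subset_of_nonneg hG fun _ _ _ => (Real.exp_pos _).le)
    rw [← mul_one (G.card : ℝ), ← nsmul_eq_mul]
    refine Finset.card_nsmul_le_sum _ _ _ fun A hA => ?_
    exact Real.one_le_exp (by nlinarith [hfG A hA])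
  have hmul := mul_le_mul hG' hH' (by positivity) (by positivity)
  have hV : V + V - l * D ≤ -(D ^ 2 / c) := by
    have h1 : V ≤ (2 * l) ^ 2 / 32 * c := mul_le_mul_of_nonneg_left htc (by positivity)
    have h2 : (2 * l) ^ 2 / 32 * c + (2 * l) ^ 2 / 32 * c - l * D = -(D ^ 2 / c) := by
      rw [hl]; field_simp; ring
    linarith
  calc (G.card : ℝ) * H.card
      = G.card * (H.card * Real.exp (l * D)) * Real.exp (-(l * D)) := by
        rw [Real.exp_neg]; field_simp
    _ ≤ T * Real.exp (-l * m / T + V) * (T * Real.exp (l * m / T + V))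
          * Real.exp (-(l * D)) := by gcongr
    _ = T ^ 2 * Real.exp (V + V - l * D) := by
        rw [show V + V - l * D = (-l * m / T + V) + (l * m / T + V) + -(l * D) by ring,
          Real.exp_add (-l * m / T + V + (l * m / T + V)),
          Real.exp_add (-l * m / T + V) (l * m / T + V)]
        ring
    _ ≤ _ := by gcongr

variable {α : Type*}

/-- The subsets of `s` containing half of its elements, rounded down or up. -/
def halfSubsets (s : Finset α) : Finset (Finset α) :=
  s.powerset.filter fun A => A.card = s.card / 2 ∨ A.card = (s.card + 1) / 2

theorem mem_halfSubsets {s A : Finset α} :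
    A ∈ halfSubsets s ↔ A ⊆ s ∧ (A.card = s.card / 2 ∨ A.card = (s.card + 1) / 2) := by
  simp [halfSubsets]

theorem halfSubsets_nonempty (s : Finset α) : (halfSubsets s).Nonempty := by
  obtain ⟨A, hA, hc⟩ := Finset.exists_subset_card_eq (s := s) (n := s.card / 2) (by omega)
  exact ⟨A, mem_halfSubsets.2 ⟨hA, Or.inl hc⟩⟩

/-- `s`, with one more element if its number of elements is odd. -/
def evenExtension (s : Finset α) : Finset (Option α) :=
  if s.card % 2 = 0 then s.map Function.Embedding.some else s.insertNone

theorem card_evenExtension (s : Finset α) : (evenExtension s).card = 2 * ((s.card + 1) / 2) := by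
  unfold evenExtension
  split_ifs
  · rw [Finset.card_map]; omega
  · rw [Finset.card_insertNone]; omega

theorem eraseNone_evenExtension (s : Finset α) : (evenExtension s).eraseNone = s := by
  unfold evenExtension
  split_ifs <;> simp

theorem exists_eraseNone_eq {s A : Finset α} (hA : A ∈ halfSubsets s) :
    ∃ B ∈ (evenExtension s).powersetCard ((s.card + 1) / 2), B.eraseNone = A := by
  rw [mem_halfSubsets] at hA
  by_cases h : A.card = (s.card + 1) / 2
  · refine ⟨A.map Function.Embedding.some, ?_, by simp⟩
    rw [Finset.mem_powersetCard, Finset.card_map]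
    refine ⟨?_, h⟩
    intro x hx
    obtain ⟨y, hy, rfl⟩ := Finset.mem_map.1 hx
    rw [Function.Embedding.some_apply, ← Finset.mem_eraseNone, eraseNone_evenExtension]
    exact hA.1 hy
  · refine ⟨A.insertNone, ?_, by simp⟩
    rw [Finset.mem_powersetCard, Finset.card_insertNone, evenExtension, if_neg (by omega)]
    exact ⟨Finset.insertNone.monotone hA.1, by omega⟩

variable [DecidableEq α]

theorem sdiff_mem_halfSubsets {s A : Finset α} (hA : A ∈ halfSubsets s) :
    s \ A ∈ halfSubsets s := by
  rw [mem_halfSubsets] at hA ⊢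
  refine ⟨Finset.sdiff_subset, ?_⟩
  rw [Finset.card_sdiff_of_subset hA.1]
  omega

/-- Once the cardinality is fixed, the erased set tells whether `none` was present. For odd `s` the
two sizes of half-subsets thus become a single slice of an even set. -/
theorem eraseNone_injOn_card (k : ℕ) :
    Set.InjOn (fun A : Finset (Option α) => A.eraseNone) {A | A.card = k} := by
  intro A hA B hB h
  have hN : ∀ C : Finset (Option α), none ∈ C ↔ C.card = C.eraseNone.card + 1 := by
    intro C
    by_cases hC : none ∈ C
    · have := Finset.card_pos.2 ⟨_, hC⟩
      rw [Finset.card_eraseNone_of_mem hC]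
      simp only [hC, true_iff]
      omega
    · rw [Finset.card_eraseNone_of_not_mem hC]
      simp [hC]
  change A.card = k at hA
  change B.card = k at hB
  change A.eraseNone = B.eraseNone at h
  ext (_ | x)
  · rw [hN, hN, h, hA, hB]
  · rw [← Finset.mem_eraseNone, ← Finset.mem_eraseNone, h]

theorem eraseNone_mem_halfSubsets {s : Finset α} {B : Finset (Option α)}
    (hB : B ∈ (evenExtension s).powersetCard ((s.card + 1) / 2)) :
    B.eraseNone ∈ halfSubsets s := by
  rw [Finset.mem_powersetCard] at hB
  rw [mem_halfSubsets]
  refine ⟨(Finset.eraseNone.monotone hB.1).trans (eraseNone_evenExtension s).le, ?_⟩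
  by_cases hN : none ∈ B
  · have h1 := Finset.card_eraseNone_of_mem hN
    have h2 := hB.1 hN
    unfold evenExtension at h2
    split_ifs at h2 with h3
    · simp at h2
    · omega
  · rw [Finset.card_eraseNone_of_not_mem hN]
    exact Or.inr hB.2

theorem card_filter_eraseNone {s : Finset α} {F : Finset (Finset α)} (hF : F ⊆ halfSubsets s) :
    (((evenExtension s).powersetCard ((s.card + 1) / 2)).filter (fun B => B.eraseNone ∈ F)).card
      = F.card := by
  refine Finset.card_nbij (fun B => B.eraseNone) ?_ ?_ ?_
  · intro B hB
    exact (Finset.mem_filter.1 hB).2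
  · refine (eraseNone_injOn_card ((s.card + 1) / 2)).mono ?_
    intro B hB
    exact (Finset.mem_powersetCard.1 (Finset.mem_filter.1 hB).1).2
  · intro A hA
    obtain ⟨B, hB, rfl⟩ := exists_eraseNone_eq (hF hA)
    exact ⟨B, Finset.mem_filter.2 ⟨hB, hA⟩, rfl⟩

theorem card_powersetCard_evenExtension (s : Finset α) :
    ((evenExtension s).powersetCard ((s.card + 1) / 2)).card = (halfSubsets s).card := by
  rw [← card_filter_eraseNone (Finset.Subset.refl (halfSubsets s)), Finset.filter_true_of_mem]
  exact fun B hB => eraseNone_mem_halfSubsets hB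

theorem card_symmDiff_triangle (A B C : Finset α) :
    (symmDiff A C).card ≤ (symmDiff A B).card + (symmDiff B C).card :=
  (Finset.card_le_card (symmDiff_triangle A B C)).trans (Finset.card_union_le _ _)

theorem card_symmDiff_eraseNone_insert (B : Finset (Option α)) (x y : Option α) :
    (symmDiff (insert x B).eraseNone (insert y B).eraseNone).card ≤ 2 := by
  have h : (symmDiff (insert x B).eraseNone (insert y B).eraseNone)
      ⊆ ({x, y} : Finset (Option α)).eraseNone := by
    intro z hz
    simp only [Finset.mem_symmDiff, Finset.mem_eraseNone, Finset.mem_insert,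
      Finset.mem_singleton] at hz ⊢
    tauto
  exact (Finset.card_le_card h).trans ((Finset.card_eraseNone_le _).trans Finset.card_le_two)

/-- A family of half-subsets of `s` that is far from the family of its complements is small. -/
theorem card_le_of_far_from_compl {s : Finset α} {F : Finset (Finset α)}
    (hF : F ⊆ halfSubsets s) {D : ℕ}
    (hD : ∀ A ∈ F, ∀ B ∈ F, D ≤ (symmDiff A (s \ B)).card) {c : ℝ}
    (hc : 3 * ((s.card : ℝ) + 1) ≤ c) :
    (F.card : ℝ) ≤ (halfSubsets s).card * Real.exp (-((D : ℝ) ^ 2 / (2 * c))) := by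
  have hc0 : 0 < c := lt_of_lt_of_le (by positivity) hc
  rcases F.eq_empty_or_nonempty with rfl | hFne
  · simp only [Finset.card_empty, Nat.cast_zero]; positivity
  set F' := F.image (s \ ·) with hF'
  have hF'sub : F' ⊆ halfSubsets s := by
    intro A hA
    obtain ⟨B, hB, rfl⟩ := Finset.mem_image.1 hA
    exact sdiff_mem_halfSubsets (hF hB)
  have hF'card : F'.card = F.card := by
    refine Finset.card_image_of_injOn fun A hA B hB h => ?_
    rw [← Finset.sdiff_sdiff_eq_self (mem_halfSubsets.1 (hF hA)).1,
      ← Finset.sdiff_sdiff_eq_self (mem_halfSubsets.1 (hF hB)).1]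
    exact congrArg (s \ ·) h
  -- The distance to `F`: it is zero on `F` and at least `D` on the complements, and an exchange
  -- changes it by at most 2.
  set ρ : Finset (Option α) → ℕ := fun A => F.inf' hFne fun B => (symmDiff B A.eraseNone).card
  have hρ : ∀ B x y, ρ (insert x B) ≤ ρ (insert y B) + 2 := by
    intro B x y
    obtain ⟨C, hC, hCe⟩ := Finset.exists_mem_eq_inf' hFne
      fun C => (symmDiff C (insert y B).eraseNone).card
    have h1 : ρ (insert x B) ≤ (symmDiff C (insert x B).eraseNone).card :=
      Finset.inf'_le (fun C => (symmDiff C (insert x B).eraseNone).card) hC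
    have h2 := card_symmDiff_triangle C (insert y B).eraseNone (insert x B).eraseNone
    have h3 := card_symmDiff_eraseNone_insert B y x
    have h4 : ρ (insert y B) = _ := hCe
    omega
  have main := card_mul_card_le_of_isSwapLipschitzOn (t := evenExtension s)
    (k := (s.card + 1) / 2) (f := fun A => (ρ A : ℝ)) (c := c) (D := D)
    (G := ((evenExtension s).powersetCard ((s.card + 1) / 2)).filter (fun B => B.eraseNone ∈ F))
    (H := ((evenExtension s).powersetCard ((s.card + 1) / 2)).filter (fun B => B.eraseNone ∈ F'))
    (by
      intro B _ x _ y _ _ _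
      have h1 : (ρ (insert x B) : ℝ) ≤ ρ (insert y B) + 2 := by exact_mod_cast hρ B x y
      have h2 : (ρ (insert y B) : ℝ) ≤ ρ (insert x B) + 2 := by exact_mod_cast hρ B y x
      exact abs_le.2 ⟨by linarith, by linarith⟩)
    (Finset.filter_subset _ _) (Finset.filter_subset _ _) (by positivity)
    (by
      intro A hA
      have : ρ A ≤ (symmDiff A.eraseNone A.eraseNone).card :=
        Finset.inf'_le (fun B => (symmDiff B A.eraseNone).card) (Finset.mem_filter.1 hA).2
      rw [symmDiff_self] at this
      have : ρ A ≤ 0 := this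
      exact_mod_cast this)
    (by
      intro A hA
      obtain ⟨B, hB, hBA⟩ := Finset.mem_image.1 (Finset.mem_filter.1 hA).2
      have : D ≤ ρ A := Finset.le_inf' _ _ fun C hC => by rw [← hBA]; exact hD C hC B hB
      exact_mod_cast this)
    hc0
    (by
      refine (sliceVariance_le _).trans (le_trans ?_ hc)
      have : (evenExtension s).card ≤ s.card + 1 := by rw [card_evenExtension]; omega
      have : ((evenExtension s).card : ℝ) ≤ s.card + 1 := by exact_mod_cast this
      linarith)
  rw [card_filter_eraseNone hF, card_filter_eraseNone hF'sub, hF'card,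
    card_powersetCard_evenExtension] at main
  -- Since `F` and `F'` have equal size, the product bound is a bound on a square.
  refine le_of_pow_le_pow_left₀ two_ne_zero (by positivity) ?_
  rw [mul_pow, ← Real.exp_nat_mul, pow_two]
  refine main.trans (le_of_eq ?_)
  congr 2
  push_cast
  field_simp

end Isoperimetry

/-! ### Crossovers in the hypercube -/

section Hypercube

variable {d : ℕ}

/-- The coordinates in which two vertices of the hypercube differ. -/
def diffSet (x y : Fin d → Bool) : Finset (Fin d) := Finset.univ.filter fun i => x i ≠ y i

theorem mem_diffSet {x y : Fin d → Bool} {i : Fin d} : i ∈ diffSet x y ↔ x i ≠ y i := by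
  simp [diffSet]

/-- The vertex `x` with the coordinates in `A` flipped. -/
def flipOn (x : Fin d → Bool) (A : Finset (Fin d)) : Fin d → Bool :=
  fun i => xor (x i) (decide (i ∈ A))

theorem flipOn_flipOn (x : Fin d → Bool) (A : Finset (Fin d)) : flipOn (flipOn x A) A = x := by
  funext i
  simp [flipOn]

theorem diffSet_flipOn_flipOn (x y : Fin d → Bool) (A B : Finset (Fin d)) :
    diffSet (flipOn x A) (flipOn y B) = symmDiff (diffSet x y) (symmDiff A B) := by
  ext i
  simp only [mem_diffSet, flipOn, Finset.mem_symmDiff]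
  by_cases hA : i ∈ A <;> by_cases hB : i ∈ B <;> cases x i <;> cases y i <;> simp [hA, hB]

theorem diffSet_flipOn_same (x y : Fin d → Bool) (A : Finset (Fin d)) :
    diffSet (flipOn x A) (flipOn y A) = diffSet x y := by
  rw [diffSet_flipOn_flipOn, symmDiff_self, symmDiff_bot]

theorem flipOn_empty (x : Fin d → Bool) : flipOn x ∅ = x := by
  funext i
  simp [flipOn]

theorem dist_eq_card_diffSet (x y : Fin d → Bool) :
    (hypercubeGraph d).dist x y = (diffSet x y).card :=
  hypercubeGraph_dist d x y

theorem isSymmMidpoint_flipOn {x y : Fin d → Bool} {A : Finset (Fin d)}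
    (hA : A ∈ halfSubsets (diffSet x y)) :
    (hypercubeGraph d).IsSymmMidpoint x y (flipOn x A) := by
  have h1 : diffSet x (flipOn x A) = A := by
    have := diffSet_flipOn_flipOn x x ∅ A
    rw [flipOn_empty] at this
    rw [this]
    ext i
    simp [mem_diffSet, Finset.mem_symmDiff]
  have h2 : diffSet (flipOn x A) y = diffSet x y \ A := by
    have := diffSet_flipOn_flipOn x y A ∅
    rw [flipOn_empty] at this
    rw [this]
    have hs := (mem_halfSubsets.1 hA).1
    ext i
    have := @hs i
    simp only [Finset.mem_symmDiff, Finset.mem_sdiff, Finset.notMem_empty]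
    tauto
  have hle := Finset.card_le_card (mem_halfSubsets.1 hA).1
  rw [SimpleGraph.IsSymmMidpoint, dist_eq_card_diffSet, dist_eq_card_diffSet,
    dist_eq_card_diffSet, h1, h2, Finset.card_sdiff_of_subset (mem_halfSubsets.1 hA).1]
  exact ⟨by omega, (mem_halfSubsets.1 hA).2⟩

theorem isSymmMidpoint_flipOn_right {x y : Fin d → Bool} {A : Finset (Fin d)}
    (hA : A ∈ halfSubsets (diffSet x y)) :
    (hypercubeGraph d).IsSymmMidpoint x y (flipOn y A) := by
  have h := sdiff_mem_halfSubsets hA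
  have e : flipOn y A = flipOn x (diffSet x y \ A) := by
    have hs := (mem_halfSubsets.1 hA).1
    funext i
    have := @hs i
    simp only [mem_diffSet, flipOn, Finset.mem_sdiff] at this ⊢
    by_cases hi : i ∈ A <;> cases hx : x i <;> cases hy : y i <;> simp_all
  rw [e]
  exact isSymmMidpoint_flipOn h

theorem flipOn_mem_symmMidpoints {S T : Finset (Fin d → Bool)} {x y : Fin d → Bool}
    {A : Finset (Fin d)} (hA : A ∈ halfSubsets (diffSet x y)) (hS : flipOn x A ∈ S)
    (hT : flipOn y A ∈ T) :
    x ∈ (hypercubeGraph d).symmMidpoints S T ∧ y ∈ (hypercubeGraph d).symmMidpoints S T := by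
  have hA' : A ∈ halfSubsets (diffSet (flipOn x A) (flipOn y A)) := by
    rwa [diffSet_flipOn_same]
  have h1 := isSymmMidpoint_flipOn hA'
  have h2 := isSymmMidpoint_flipOn_right hA'
  rw [flipOn_flipOn] at h1 h2
  simp only [SimpleGraph.symmMidpoints, Finset.mem_filter, Finset.mem_univ, true_and]
  exact ⟨⟨_, hS, _, hT, h1⟩, ⟨_, hS, _, hT, h2⟩⟩

/-- The crossovers of `x` and `y` that lie in `S × T` form a small family. -/
theorem card_crossovers_le (S T : Finset (Fin d → Bool)) (x y : Fin d → Bool) :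
    (((halfSubsets (diffSet x y)).filter fun A => flipOn x A ∈ S ∧ flipOn y A ∈ T).card : ℝ)
      ≤ (halfSubsets (diffSet x y)).card *
        Real.exp (-(((hypercubeGraph d).setDist S T : ℝ) ^ 2 / (2 * (3 * ((d : ℝ) + 1))))) := by
  refine card_le_of_far_from_compl (Finset.filter_subset _ _) ?_ ?_
  · intro A hA B hB
    rw [Finset.mem_filter] at hA hB
    have hle : (hypercubeGraph d).setDist S T ≤ (hypercubeGraph d).dist (flipOn x A) (flipOn y B) :=
      Nat.sInf_le ⟨_, hA.2.1, _, hB.2.2, rfl⟩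
    rw [dist_eq_card_diffSet, diffSet_flipOn_flipOn] at hle
    refine hle.trans (le_of_eq ?_)
    have hs := (mem_halfSubsets.1 hB.1).1
    congr 1
    ext i
    have := @hs i
    simp only [Finset.mem_symmDiff, Finset.mem_sdiff]
    tauto
  · have : (diffSet x y).card ≤ d := (Finset.card_le_univ _).trans (by simp)
    have : ((diffSet x y).card : ℝ) ≤ d := by exact_mod_cast this
    linarith

/-- Flipping the same coordinates of two vertices, as a permutation. -/
def crossover (d : ℕ) : Equiv.Perm (((Fin d → Bool) × (Fin d → Bool)) × Finset (Fin d)) :=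
  Function.Involutive.toPerm (fun q => ((flipOn q.1.1 q.2, flipOn q.1.2 q.2), q.2)) fun q => by
    simp [flipOn_flipOn]

theorem card_mul_card_le_card_symmMidpoints_sq (S T : Finset (Fin d → Bool)) :
    (S.card : ℝ) * T.card ≤ ((hypercubeGraph d).symmMidpoints S T).card ^ 2 *
      Real.exp (-(((hypercubeGraph d).setDist S T : ℝ) ^ 2 / (2 * (3 * ((d : ℝ) + 1))))) := by
  classical
  set E := Real.exp (-(((hypercubeGraph d).setDist S T : ℝ) ^ 2 / (2 * (3 * ((d : ℝ) + 1)))))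
  set m := (hypercubeGraph d).symmMidpoints S T
  let P : ((Fin d → Bool) × (Fin d → Bool)) × Finset (Fin d) → Prop :=
    fun q => q.2 ∈ halfSubsets (diffSet q.1.1 q.1.2)
  let w : ((Fin d → Bool) × (Fin d → Bool)) × Finset (Fin d) → ℝ :=
    fun q => ((halfSubsets (diffSet q.1.1 q.1.2)).card : ℝ)⁻¹
  have hpos : ∀ x y : Fin d → Bool, (0 : ℝ) < (halfSubsets (diffSet x y)).card := fun x y => by
    exact_mod_cast Finset.card_pos.2 (halfSubsets_nonempty _)
  -- For each pair the weights of its half-subsets add up to one.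
  have h1 : (S.card : ℝ) * T.card = ∑ q, if P q ∧ q.1 ∈ S ×ˢ T then w q else 0 := by
    rw [Fintype.sum_prod_type, ← Nat.cast_mul, ← Finset.card_product, Finset.card_eq_sum_ones,
      Nat.cast_sum, ← Finset.sum_subset (Finset.subset_univ (S ×ˢ T))]
    · refine Finset.sum_congr rfl fun p hp => ?_
      simp only [hp, and_true, P, w]
      rw [← Finset.sum_filter, Finset.sum_const, Finset.filter_univ_mem, nsmul_eq_mul,
        mul_inv_cancel₀ (hpos _ _).ne', Nat.cast_one]
    · intro p _ hp
      simp [hp]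
  -- The crossover preserves the difference set, hence both `P` and `w`.
  have h2 : ∑ q, (if P q ∧ q.1 ∈ S ×ˢ T then w q else 0)
      = ∑ q, if P q ∧ flipOn q.1.1 q.2 ∈ S ∧ flipOn q.1.2 q.2 ∈ T then w q else 0 := by
    rw [← Equiv.sum_comp (crossover d)]
    refine Finset.sum_congr rfl fun q _ => ?_
    rw [show crossover d q = ((flipOn q.1.1 q.2, flipOn q.1.2 q.2), q.2) from rfl]
    simp only [P, w, diffSet_flipOn_same, Finset.mem_product]
  rw [h1, h2, Fintype.sum_prod_type, pow_two, ← Nat.cast_mul, ← Finset.card_product,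
    ← Finset.sum_subset (Finset.subset_univ (m ×ˢ m))]
  · rw [← nsmul_eq_mul]
    refine Finset.sum_le_card_nsmul _ _ _ fun p _ => ?_
    simp only [P, w]
    rw [← Finset.sum_filter, Finset.sum_const, nsmul_eq_mul, ← div_eq_mul_inv,
      div_le_iff₀ (hpos _ _), mul_comm]
    refine le_trans (le_of_eq ?_) (card_crossovers_le S T p.1 p.2)
    congr 2
    ext A
    simp
  · intro p _ hp
    refine Finset.sum_eq_zero fun A _ => if_neg ?_
    rintro ⟨hA, hS, hT⟩
    exact hp (Finset.mem_product.2 (flipOn_mem_symmMidpoints hA hS hT))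

theorem hypercubeGraph_satisfiesBrunnMinkowski (hd : 7 ≤ d) :
    (hypercubeGraph d).SatisfiesBrunnMinkowski ((1 + 1 / 6) / (2 * (d : ℝ))) := by
  intro S T _ _
  have hd' : (7 : ℝ) ≤ d := by exact_mod_cast hd
  have h := card_mul_card_le_card_symmMidpoints_sq S T
  set D : ℝ := (((hypercubeGraph d).setDist S T : ℕ) : ℝ)
  refine le_of_pow_le_pow_left₀ two_ne_zero (by positivity) ?_
  rw [mul_pow, Real.sq_sqrt (by positivity), ← Real.exp_nat_mul]
  refine (mul_le_mul_of_nonneg_right h (Real.exp_pos _).le).trans ?_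
  rw [mul_assoc, ← Real.exp_add]
  refine mul_le_of_le_one_right (by positivity) (Real.exp_le_one_iff.2 ?_)
  have : ((2 : ℕ) : ℝ) * ((1 + 1 / 6) / (2 * (d : ℝ)) / 8 * D ^ 2)
      ≤ D ^ 2 / (2 * (3 * ((d : ℝ) + 1))) := by
    rw [div_eq_mul_one_div (D ^ 2), mul_comm (D ^ 2), ← mul_assoc]
    refine mul_le_mul_of_nonneg_right ?_ (sq_nonneg D)
    -- The counting bound allows any `K ≤ 2 / (3 * (d + 1))`; for the chosen `K` this says `7 * (d +
    -- 1) ≤ 8 * d`, that is, `7 ≤ d`.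
    rw [le_div_iff₀ (by positivity)]
    field_simp
    push_cast
    linarith
  linarith

end Hypercube

theorem mainTheorem11 :
    ∃ δ : ℝ, 0 < δ ∧ ∃ D : ℕ, ∀ d : ℕ, D < d →
      (hypercubeGraph d).SatisfiesBrunnMinkowski ((1 + δ) / (2 * (d : ℝ))) ∧
      (((1 + δ) / (2 * (d : ℝ)) : ℝ) : EReal) ≤ (hypercubeGraph d).brunnMinkowskiCurvature ∧
      ((1 / (2 * (d : ℝ)) : ℝ) : EReal) < (hypercubeGraph d).brunnMinkowskiCurvature := by
  -- Any `δ < 1 / 3` would do with a larger threshold, as `2 / (3 * d)` is 4/3 times `1 / (2 * d)`.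
  refine ⟨1 / 6, by norm_num, 6, fun d hd => ?_⟩
  have h := hypercubeGraph_satisfiesBrunnMinkowski (d := d) hd
  have hle : (((1 + 1 / 6) / (2 * (d : ℝ)) : ℝ) : EReal)
      ≤ (hypercubeGraph d).brunnMinkowskiCurvature := le_sSup ⟨_, h, rfl⟩
  refine ⟨h, hle, lt_of_lt_of_le (EReal.coe_lt_coe_iff.2 ?_) hle⟩
  have hd' : (0 : ℝ) < d := by exact_mod_cast (by omega : 0 < d)
  gcongr
  norm_num
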